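/- Let $k$ be a commutative ring and let $H$ be a Hopf algebra over $k$ with counit $\varepsilon$ and antipode $S$. Assume that $H$ is involutory, i.e. $S^2=\mathrm{id}$, and Frobenius over $k$, i.e. $H$ is finitely generated projective over $k$ and $H\cong H^*=\operatorname{Hom}_k(H,k)$ as left $H$-modules, where $(af)(x)=f(xa)$. Let $\mathfrak dH$ be the ideal $\langle\varepsilon,\int_H\rangle=\{\varepsilon(a)\mid a\in\int_H\}$ of $k$, where $\int_H=\{a\in H\mid ab=\varepsilon(b)a\text{ for all }b\in H\}$ is the $k$-module of right integrals of $H$ (the left integrals give the same ideal). Let $B$ be a right $H$-comodule algebra, that is, a $k$-algebra with a coassociative and counital coaction $\rho\colon B\to B\otimes_k H$ that is a homomorphism of $k$-algebras, and let $A=\{a\in B\mid\rho(a)=a\otimes 1\}$ be its subalgebra of coinvariants. Assume that $B/A$ is a right $H$-Galois extension, i.e. at least one of the two maps $B\otimes_A B\to B\otimes_k H$ given by $b\otimes c\mapsto(b\otimes1)\rho(c)$ and by $b\otimes c\mapsto\rho(b)(c\otimes1)$ is bijective. Assume further that (i) $A$ is commutative and has no idempotents other than $0$ and $1$, and (ii)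 there is a $k$-linear form $f\colon B\to k$ with $f(xy-yx)=0$ for all $x,y\in B$ and $f(1)=1$. Then every finitely generated projective left $B$-module $M$ is, by restriction, a finitely generated projective $A$-module of constant rank, and $\operatorname{rank}_A(M)\cdot1\in\mathfrak dH$. That is, there is an integer $n\ge0$ such that for every prime ideal $\mathfrak p$ of $A$ the free $A_{\mathfrak p}$-module $M_{\mathfrak p}$ has rank $n$, and $n\cdot 1_k\in\mathfrak dH$. -/

import Mathlib

open scoped TensorProduct

namespace HopfGalois

noncomputable section

universe u v w x

section Frobenius

variable (k : Type u) [CommRing k]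

/-- A `k`-algebra `H` is Frobenius: it is finitely generated projective over `k`, and `H` is
isomorphic to `H* = Hom_k(H, k)` as a left `H`-module, where `(a • f) x = f (x * a)`. -/
def IsFrobenius (H : Type v) [Ring H] [Algebra k H] : Prop :=
  Module.Finite k H ∧ Module.Projective k H ∧
    ∃ e : H ≃ₗ[k] Module.Dual k H, ∀ a b x : H, e (a * b) x = e b (x * a)

/-- A `k`-linear form `f` on `B` is a trace form: it vanishes on all commutators `x * y - y * x`. -/
def IsTraceForm {k : Type u} [CommRing k] {B : Type w} [Ring B] [Algebra k B]
    (f : B →ₗ[k] k) : Prop :=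
  ∀ x y : B, f (x * y - y * x) = 0

end Frobenius

section Hopf

variable (k : Type u) [CommRing k] (H : Type v) [Ring H] [HopfAlgebra k H]

/-- `H` is involutory: the antipode squares to the identity. -/
def IsInvolutory : Prop :=
  ∀ h : H, HopfAlgebra.antipode k (HopfAlgebra.antipode k h) = h

/-- The right integrals `{a ∈ H | a * b = ε(b) a for all b ∈ H}`. -/
def rightIntegrals : Submodule k H where
  carrier := {a | ∀ b : H, a * b = Coalgebra.counit (R := k) b • a}
  add_mem' := by
    intro a a' ha ha' b
    rw [add_mul, ha b, ha' b, smul_add]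
  zero_mem' := by
    intro b
    rw [zero_mul, smul_zero]
  smul_mem' := by
    intro c a ha b
    rw [smul_mul_assoc, ha b, smul_comm]

/-- The left integrals `{a ∈ H | b * a = ε(b) a for all b ∈ H}`. -/
def leftIntegrals : Submodule k H where
  carrier := {a | ∀ b : H, b * a = Coalgebra.counit (R := k) b • a}
  add_mem' := by
    intro a a' ha ha' b
    rw [mul_add, ha b, ha' b, smul_add]
  zero_mem' := by
    intro b
    rw [mul_zero, smul_zero]
  smul_mem' := by
    intro c a ha b
    rw [mul_smul_comm, ha b, smul_comm]

/-- The ideal `⟨ε, ∫⟩ = {ε(a) | a a right integral of H}` of `k`. -/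
def integralIdeal : Ideal k :=
  Submodule.map (Coalgebra.counit (R := k) (A := H)) (rightIntegrals k H)

/-- Left and right integrals define the same ideal (for involutory `H`). -/
theorem integralIdeal_eq_left (hS : IsInvolutory k H) :
    integralIdeal k H =
      Submodule.map (Coalgebra.counit (R := k) (A := H)) (leftIntegrals k H) := by
  apply le_antisymm
  · rintro _ ⟨a, ha, rfl⟩
    refine ⟨HopfAlgebra.antipode k a, fun b => ?_, HopfAlgebra.counit_antipode a⟩
    have h := congrArg (HopfAlgebra.antipode k) (ha (HopfAlgebra.antipode k b))
    rwa [HopfAlgebra.antipode_mul_antidistrib, hS b, map_smul,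
      HopfAlgebra.counit_antipode] at h
  · rintro _ ⟨a, ha, rfl⟩
    refine ⟨HopfAlgebra.antipode k a, fun b => ?_, HopfAlgebra.counit_antipode a⟩
    have h := congrArg (HopfAlgebra.antipode k) (ha (HopfAlgebra.antipode k b))
    rwa [HopfAlgebra.antipode_mul_antidistrib, hS b, map_smul,
      HopfAlgebra.counit_antipode] at h

/-- A right `H`-comodule algebra structure on the `k`-algebra `B`: a coassociative and counital
coaction `ρ : B → B ⊗ H` that is a homomorphism of `k`-algebras. -/
structure RightComoduleAlgebra (B : Type w) [Ring B] [Algebra k B] where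
  /-- the coaction -/
  coaction : B →ₐ[k] B ⊗[k] H
  /-- `(ρ ⊗ id) ∘ ρ = (id ⊗ Δ) ∘ ρ` -/
  coassoc : ∀ b : B,
    TensorProduct.assoc k B H H (coaction.toLinearMap.rTensor H (coaction b)) =
      (Coalgebra.comul (R := k) (A := H)).lTensor B (coaction b)
  /-- `(id ⊗ ε) ∘ ρ = id` -/
  counit : ∀ b : B,
    (Coalgebra.counit (R := k) (A := H)).lTensor B (coaction b) = b ⊗ₜ[k] (1 : k)

end Hopf

section Balanced

variable {k : Type u} [CommRing k] {B : Type w} [Ring B] [Algebra k B]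

/-- The submodule of `B ⊗[k] B` spanned by the elements `b a ⊗ c - b ⊗ a c` with `a ∈ A`. -/
def balancedRelations (A : Subalgebra k B) : Submodule k (B ⊗[k] B) :=
  Submodule.span k {t | ∃ b a c : B, a ∈ A ∧ t = (b * a) ⊗ₜ[k] c - b ⊗ₜ[k] (a * c)}

/-- The tensor product `B ⊗_A B` over a subalgebra `A` that need not be central in `B`. -/
abbrev BalancedTensor (A : Subalgebra k B) : Type w :=
  (B ⊗[k] B) ⧸ balancedRelations A

end Balanced

namespace RightComoduleAlgebra

variable {k : Type u} [CommRing k] {H : Type v} [Ring H] [HopfAlgebra k H]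
  {B : Type w} [Ring B] [Algebra k B] (ρ : RightComoduleAlgebra k H B)

/-- The subalgebra `{a ∈ B | ρ(a) = a ⊗ 1}` of coinvariants. -/
def coinvariants : Subalgebra k B :=
  AlgHom.equalizer ρ.coaction (Algebra.TensorProduct.includeLeft : B →ₐ[k] B ⊗[k] H)

theorem mem_coinvariants (a : B) : a ∈ ρ.coinvariants ↔ ρ.coaction a = a ⊗ₜ[k] (1 : H) :=
  Iff.rfl

/-- `b ⊗ c ↦ (b ⊗ 1) ρ(c)` on `B ⊗[k] B`. -/
def preCanLeft : B ⊗[k] B →ₗ[k] B ⊗[k] H :=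
  TensorProduct.lift ((LinearMap.mul k (B ⊗[k] H)).compl₁₂
    (Algebra.TensorProduct.includeLeft : B →ₐ[k] B ⊗[k] H).toLinearMap ρ.coaction.toLinearMap)

/-- `b ⊗ c ↦ ρ(b) (c ⊗ 1)` on `B ⊗[k] B`. -/
def preCanRight : B ⊗[k] B →ₗ[k] B ⊗[k] H :=
  TensorProduct.lift ((LinearMap.mul k (B ⊗[k] H)).compl₁₂
    ρ.coaction.toLinearMap (Algebra.TensorProduct.includeLeft : B →ₐ[k] B ⊗[k] H).toLinearMap)

theorem preCanLeft_tmul (b c : B) :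
    ρ.preCanLeft (b ⊗ₜ[k] c) = (b ⊗ₜ[k] (1 : H)) * ρ.coaction c := rfl

theorem preCanRight_tmul (b c : B) :
    ρ.preCanRight (b ⊗ₜ[k] c) = ρ.coaction b * (c ⊗ₜ[k] (1 : H)) := rfl

/-- The canonical map `B ⊗_A B → B ⊗ H`, `b ⊗ c ↦ (b ⊗ 1) ρ(c)`, with `A` the coinvariants. -/
def canLeft : BalancedTensor ρ.coinvariants →ₗ[k] B ⊗[k] H :=
  Submodule.liftQ _ ρ.preCanLeft <| by
    refine Submodule.span_le.mpr ?_
    rintro _ ⟨b, a, c, ha, rfl⟩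
    rw [mem_coinvariants] at ha
    simp [preCanLeft_tmul, ha, ← mul_assoc]

/-- The canonical map `B ⊗_A B → B ⊗ H`, `b ⊗ c ↦ ρ(b) (c ⊗ 1)`, with `A` the coinvariants. -/
def canRight : BalancedTensor ρ.coinvariants →ₗ[k] B ⊗[k] H :=
  Submodule.liftQ _ ρ.preCanRight <| by
    refine Submodule.span_le.mpr ?_
    rintro _ ⟨b, a, c, ha, rfl⟩
    rw [mem_coinvariants] at ha
    simp [preCanRight_tmul, ha, mul_assoc]

/-- `B/A`, with `A` the coinvariants, is a right `H`-Galois extension: one of the two canonical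
maps is bijective (the two conditions are equivalent when the antipode is bijective). -/
def IsGaloisExtension : Prop :=
  Function.Bijective ρ.canLeft ∨ Function.Bijective ρ.canRight

end RightComoduleAlgebra

/-- The `R`-module `M` is finitely generated projective of constant rank `n`: for every prime `p`,
the `R_p`-module `M_p` (which is then free) has rank `n`. -/
def HasConstantRank (R : Type u) [CommRing R] (M : Type x) [AddCommGroup M] [Module R M]
    (n : ℕ) : Prop :=
  Module.Finite R M ∧ Module.Projective R M ∧
    ∀ p : PrimeSpectrum R, Module.rankAtStalk (R := R) M p = n

end

end HopfGalois

open scoped IsMulCommutative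

namespace HopfGalois

open Coalgebra HopfAlgebra TensorProduct

/-! The rank is computed as the trace of an explicit finite dual basis of `M` over the coinvariants
`A`. The Frobenius property yields a left integral `t` of `H` and an integral `lam` of the dual with
`lam t = 1` (`exists_integrals`). The map `E(b) = Σ lam(b₁) b₀` sends `B` to `A` and is left
`A`-linear. Surjectivity of the canonical map gives `Σ ρ(lᵢ)(rᵢ ⊗ 1) = 1 ⊗ t`, whence `b = Σ E(b lᵢ)
rᵢ` (`sum_expectation_mul`): the `rᵢ` and `E(· lᵢ)` form a dual basis of `B` over `A`.

If `mⱼ`, `gⱼ` is a dual basis of `M` over `B`, then `rᵢ mⱼ` and `E(gⱼ(·) lᵢ)` form one over `A`, and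
its trace is `Σ E(rᵢ b lᵢ)` with `b = Σ gⱼ(mⱼ)`. As `A` has no nontrivial idempotents, the rank is a
constant `n`, and this trace equals `n` in `A`.

A trace form `f` allows `lᵢ` to be moved cyclically to the front. Since `S² = id`, `Σ l₀r₀ ⊗ r₁ ⊗ l₁
= 1 ⊗ S(t₁) ⊗ t₂`, and `Σ lam(S(t₁) h t₂) = ε(t) lam(S(h))`. Hence `n = f(n)` is a multiple of
`ε(t)` (`trace_sum_expectation`). -/

theorem exists_dualBasis (R M : Type*) [Ring R] [AddCommGroup M] [Module R M] [Module.Finite R M]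
    [Module.Projective R M] :
    ∃ (n : ℕ) (v : Fin n → M) (g : Fin n → M →ₗ[R] R), ∀ x, ∑ i, g i x • v i = x := by
  obtain ⟨n, f, g, -, -, hfg⟩ := Module.Finite.exists_comp_eq_id_of_projective R M
  refine ⟨n, fun i => f (Pi.single i 1), fun i => LinearMap.proj i ∘ₗ g, fun x => ?_⟩
  conv_rhs => rw [← LinearMap.id_apply (R := R) x, ← hfg, LinearMap.comp_apply,
    pi_eq_sum_univ' (g x), map_sum]
  refine Finset.sum_congr rfl fun i _ => ?_
  rw [← map_smul]
  rfl

/-! ### Antipode identities in a Hopf algebra -/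

section HopfIdentities

variable {k : Type*} [CommRing k] {H : Type*} [Ring H] [HopfAlgebra k H]

/-- The linear map `u ⊗ v ↦ (S u ⊗ 1) Δ(v)`. -/
noncomputable def antipodeMulComul (k H : Type*) [CommRing k] [Ring H] [HopfAlgebra k H] :
    H ⊗[k] H →ₗ[k] H ⊗[k] H :=
  lift ((LinearMap.mul k (H ⊗[k] H)).compl₁₂
    ((Algebra.TensorProduct.includeLeft : H →ₐ[k] H ⊗[k] H).toLinearMap ∘ₗ antipode k)
    (comul : H →ₗ[k] H ⊗[k] H))

theorem antipodeMulComul_tmul (u v : H) :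
    antipodeMulComul k H (u ⊗ₜ v) = (antipode k u ⊗ₜ[k] (1 : H)) * comul (R := k) v := rfl

/-- `Σ (S(h₁) ⊗ 1) Δ(h₂) = 1 ⊗ h`. -/
theorem antipodeMulComul_comul (h : H) :
    antipodeMulComul k H (comul (R := k) h) = 1 ⊗ₜ h := by
  have key : antipodeMulComul k H =
      (LinearMap.mul' k H ∘ₗ (antipode k).rTensor H).rTensor H ∘ₗ
        (TensorProduct.assoc k H H H).symm.toLinearMap ∘ₗ
          (comul : H →ₗ[k] H ⊗[k] H).lTensor H := by
    ext u v
    simp only [AlgebraTensorModule.curry_apply, curry_apply, LinearMap.coe_restrictScalars,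
      antipodeMulComul_tmul, LinearMap.comp_apply, LinearMap.lTensor_tmul,
      LinearEquiv.coe_coe]
    induction comul (R := k) v using TensorProduct.induction_on with
    | zero => simp
    | tmul x y => simp
    | add x y hx hy => rw [mul_add, hx, hy, tmul_add, map_add, map_add]
  rw [key, LinearMap.comp_apply, LinearMap.comp_apply, LinearEquiv.coe_coe, coassoc_symm_apply,
    ← LinearMap.comp_apply, ← LinearMap.rTensor_comp, LinearMap.comp_assoc,
    mul_antipode_rTensor_comul, LinearMap.rTensor_comp, LinearMap.comp_apply,
    rTensor_counit_comul]
  simp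

/-- For a left integral `t`, `(1 ⊗ h) Δ(t) = (S(h) ⊗ 1) Δ(t)`. -/
theorem one_tmul_mul_comul_of_mem_leftIntegrals {t : H} (ht : t ∈ leftIntegrals k H) (h : H) :
    ((1 : H) ⊗ₜ[k] h) * comul (R := k) t = (antipode k h ⊗ₜ[k] (1 : H)) * comul (R := k) t := by
  have key : ∀ z : H ⊗[k] H, antipodeMulComul k H z * comul (R := k) t =
      (antipode k (TensorProduct.rid k H ((counit (R := k) (A := H)).lTensor H z)) ⊗ₜ[k] (1 : H)) *
        comul (R := k) t := by
    intro z
    induction z using TensorProduct.induction_on with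
    | zero => simp
    | tmul u v =>
      -- `Δ(v) Δ(t) = Δ(vt) = ε(v) Δ(t)`, so the factor `v` collapses to its counit.
      rw [antipodeMulComul_tmul, mul_assoc, ← Bialgebra.comul_mul, ht v]
      simp [← smul_tmul']
    | add x y hx hy => simp only [map_add, add_mul, add_tmul, hx, hy]
  have := key (comul (R := k) h)
  rwa [antipodeMulComul_comul, lTensor_counit_comul, TensorProduct.rid_tmul, one_smul] at this

/-- `Σ S(z₂) z₁ = ε(z)` for an involutory Hopf algebra. -/
theorem sum_antipode_right_mul_left (hS : IsInvolutory k H) {z : H} {ι : Type*}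
    (r : Coalgebra.Repr k z ι) :
    ∑ i ∈ r.index, antipode k (r.right i) * r.left i = counit (R := k) z • (1 : H) := by
  have := congrArg (antipode k) (sum_antipode_mul_eq_smul (R := k) r)
  simpa [antipode_mul_antidistrib, hS _] using this

/-- `u ⊗ v ↦ (S(v₁) ⊗ v₂) (u ⊗ 1)`. -/
noncomputable def antipodeComulMul (k H : Type*) [CommRing k] [Ring H] [HopfAlgebra k H] :
    H ⊗[k] H →ₗ[k] H ⊗[k] H :=
  lift ((LinearMap.mul k (H ⊗[k] H)).compl₁₂
    ((antipode k).rTensor H ∘ₗ (comul : H →ₗ[k] H ⊗[k] H))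
    (Algebra.TensorProduct.includeLeft : H →ₐ[k] H ⊗[k] H).toLinearMap).flip

theorem antipodeComulMul_tmul (u v : H) :
    antipodeComulMul k H (u ⊗ₜ v) =
      (antipode k).rTensor H (comul (R := k) v) * (u ⊗ₜ[k] (1 : H)) := rfl

/-- `Σ S(h₂) h₁ ⊗ h₃ = 1 ⊗ h` for an involutory Hopf algebra. -/
theorem antipodeComulMul_comul (hS : IsInvolutory k H) (h : H) :
    antipodeComulMul k H (comul (R := k) h) = 1 ⊗ₜ h := by
  have hm : (LinearMap.mul' k H ∘ₗ (antipode k).rTensor H ∘ₗ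
      (TensorProduct.comm k H H).toLinearMap) ∘ₗ (comul : H →ₗ[k] H ⊗[k] H) =
      Algebra.linearMap k H ∘ₗ counit := by
    ext z
    have := sum_antipode_right_mul_left hS (Coalgebra.Repr.arbitrary k z)
    rw [LinearMap.comp_apply, ← (Coalgebra.Repr.arbitrary k z).eq]
    simpa [Algebra.algebraMap_eq_smul_one] using this
  have key : antipodeComulMul k H =
      (LinearMap.mul' k H ∘ₗ (antipode k).rTensor H ∘ₗ
        (TensorProduct.comm k H H).toLinearMap).rTensor H ∘ₗ
        (TensorProduct.assoc k H H H).symm.toLinearMap ∘ₗ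
          (comul : H →ₗ[k] H ⊗[k] H).lTensor H := by
    ext u v
    simp only [AlgebraTensorModule.curry_apply, curry_apply, LinearMap.coe_restrictScalars,
      antipodeComulMul_tmul, LinearMap.comp_apply, LinearMap.lTensor_tmul,
      LinearEquiv.coe_coe]
    induction comul (R := k) v using TensorProduct.induction_on with
    | zero => simp
    | tmul x y => simp
    | add x y hx hy => rw [map_add, add_mul, hx, hy, tmul_add, map_add, map_add]
  rw [key, LinearMap.comp_apply, LinearMap.comp_apply, LinearEquiv.coe_coe, coassoc_symm_apply,
    ← LinearMap.comp_apply, ← LinearMap.rTensor_comp, hm, LinearMap.rTensor_comp,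
    LinearMap.comp_apply, rTensor_counit_comul]
  simp

end HopfIdentities

/-! ### Integrals of an involutory Frobenius Hopf algebra and of its dual -/

section Integrals

variable {k : Type*} [CommRing k] {H : Type*} [Ring H] [HopfAlgebra k H]

/-- The slice `x ⊗ h ↦ φ(h) x` of `B ⊗ H` along a linear form `φ` on `H`. -/
noncomputable def slice (B : Type*) [Ring B] [Algebra k B] (φ : H →ₗ[k] k) : B ⊗[k] H →ₗ[k] B :=
  (TensorProduct.rid k B).toLinearMap ∘ₗ φ.lTensor B

theorem slice_tmul {B : Type*} [Ring B] [Algebra k B] (φ : H →ₗ[k] k) (b : B) (h : H) :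
    slice B φ (b ⊗ₜ h) = φ h • b := by
  simp [slice]

theorem slice_mul_left {B : Type*} [Ring B] [Algebra k B] (φ : H →ₗ[k] k) (b : B)
    (X : B ⊗[k] H) : slice B φ ((b ⊗ₜ[k] (1 : H)) * X) = b * slice B φ X := by
  induction X using TensorProduct.induction_on with
  | zero => simp
  | tmul x y => simp [slice_tmul]
  | add x y hx hy => simp only [mul_add, map_add, hx, hy]

theorem slice_mul_right {B : Type*} [Ring B] [Algebra k B] (φ : H →ₗ[k] k) (b : B)
    (X : B ⊗[k] H) : slice B φ (X * (b ⊗ₜ[k] (1 : H))) = slice B φ X * b := by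
  induction X using TensorProduct.induction_on with
  | zero => simp
  | tmul x y => simp [slice_tmul]
  | add x y hx hy => simp only [add_mul, map_add, hx, hy]

theorem slice_one_tmul_mul {B : Type*} [Ring B] [Algebra k B] (φ : H →ₗ[k] k) (h : H)
    (X : B ⊗[k] H) :
    slice B φ (((1 : B) ⊗ₜ[k] h) * X) = slice B (φ ∘ₗ LinearMap.mulLeft k h) X := by
  induction X using TensorProduct.induction_on with
  | zero => simp
  | tmul x y => simp [slice_tmul]
  | add x y hx hy => simp only [mul_add, map_add, hx, hy]

theorem slice_mul_one_tmul {B : Type*} [Ring B] [Algebra k B] (φ : H →ₗ[k] k) (h : H)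
    (X : B ⊗[k] H) :
    slice B φ (X * ((1 : B) ⊗ₜ[k] h)) = slice B (φ ∘ₗ LinearMap.mulRight k h) X := by
  induction X using TensorProduct.induction_on with
  | zero => simp
  | tmul x y => simp [slice_tmul]
  | add x y hx hy => simp only [add_mul, map_add, hx, hy]

/-- The left action `φ ⇀ h = Σ φ(h₂) h₁` of the dual algebra on `H`. -/
noncomputable def dualAct (φ : H →ₗ[k] k) : H →ₗ[k] H := slice H φ ∘ₗ comul

theorem dualAct_apply (φ : H →ₗ[k] k) (h : H) : dualAct φ h = slice H φ (comul h) := rfl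

/-- By coassociativity both sides are `Σ ψ(h₂) φ(h₃) h₁`; the form `ψ ∘ₗ dualAct φ` is the
convolution product of `ψ` and `φ`. -/
theorem dualAct_dualAct (ψ φ : H →ₗ[k] k) (h : H) :
    dualAct ψ (dualAct φ h) = dualAct (ψ ∘ₗ dualAct φ) h := by
  have key : ∀ X : H ⊗[k] H, dualAct ψ (slice H φ X) = slice H (1 : k →ₗ[k] k)
      ((ψ ∘ₗ slice H φ).lTensor H
        (TensorProduct.assoc k H H H ((comul : H →ₗ[k] H ⊗[k] H).rTensor H X))) := by
    intro X
    induction X using TensorProduct.induction_on with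
    | zero => simp
    | tmul x y =>
      rw [slice_tmul, map_smul, dualAct_apply, LinearMap.rTensor_tmul]
      induction comul (R := k) x using TensorProduct.induction_on with
      | zero => simp
      | tmul u v => simp [slice_tmul, smul_smul]
      | add u v hu hv => simp only [map_add, smul_add, add_tmul, hu, hv]
    | add x y hx hy => simp only [map_add, hx, hy]
  rw [dualAct_apply φ, key, coassoc_apply, dualAct_apply]
  induction comul (R := k) h using TensorProduct.induction_on with
  | zero => simp
  | tmul u v => simp [slice_tmul, dualAct_apply]
  | add u v hu hv => simp only [map_add, hu, hv]

theorem counit_dualAct (φ : H →ₗ[k] k) (h : H) : counit (R := k) (dualAct φ h) = φ h := by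
  have key : ∀ X : H ⊗[k] H, counit (R := k) (slice H φ X) =
      φ (TensorProduct.lid k H ((counit (R := k) (A := H)).rTensor H X)) := by
    intro X
    induction X using TensorProduct.induction_on with
    | zero => simp
    | tmul x y => simp [slice_tmul, mul_comm]
    | add x y hx hy => simp only [map_add, hx, hy]
  rw [dualAct_apply, key, rTensor_counit_comul, TensorProduct.lid_tmul, one_smul]

theorem dualAct_one (φ : H →ₗ[k] k) : dualAct φ (1 : H) = φ 1 • (1 : H) := by
  rw [dualAct_apply, Bialgebra.comul_one, Algebra.TensorProduct.one_def, slice_tmul]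

theorem mul_dualAct_of_mem_leftIntegrals (hS : IsInvolutory k H) {t : H}
    (ht : t ∈ leftIntegrals k H) (φ : H →ₗ[k] k) (x : H) :
    x * dualAct φ t = dualAct (φ ∘ₗ LinearMap.mulLeft k (antipode k x)) t := by
  rw [dualAct_apply, dualAct_apply, ← slice_one_tmul_mul,
    one_tmul_mul_comul_of_mem_leftIntegrals ht, hS x, slice_mul_left]

/-- The map `φ ↦ (φ ⇀ t)`. -/
noncomputable def dualActOn (t : H) : Module.Dual k H →ₗ[k] H where
  toFun φ := dualAct φ t
  map_add' φ ψ := by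
    simp [dualAct, slice, LinearMap.lTensor_add]
  map_smul' c φ := by
    simp [dualAct, slice, LinearMap.lTensor_smul]

/-- The range is stable under left multiplication and under the dual action, and `β ⇀ t` is an
element `z` of it with `ε(z) = 1`. Then `1 = Σ S(z₂) z₁` lies in the range too, so the range is all
of `H`. -/
theorem dualActOn_surjective [Module.Finite k H] [Module.Projective k H]
    (hS : IsInvolutory k H) {t : H} (ht : t ∈ leftIntegrals k H) {β : H →ₗ[k] k} (hβ : β t = 1) :
    Function.Surjective (dualActOn (k := k) t) := by
  obtain ⟨n, v, g, hrep⟩ := exists_dualBasis k H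
  have hmul : ∀ x z, z ∈ LinearMap.range (dualActOn (k := k) t) →
      x * z ∈ LinearMap.range (dualActOn (k := k) t) := by
    rintro x _ ⟨φ, rfl⟩
    exact ⟨_, (mul_dualAct_of_mem_leftIntegrals hS ht φ x).symm⟩
  have hact : ∀ (ψ : H →ₗ[k] k) z, z ∈ LinearMap.range (dualActOn (k := k) t) →
      dualAct ψ z ∈ LinearMap.range (dualActOn (k := k) t) := by
    rintro ψ _ ⟨φ, rfl⟩
    exact ⟨_, (dualAct_dualAct ψ φ t).symm⟩
  have hone : (1 : H) ∈ LinearMap.range (dualActOn (k := k) t) := by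
    obtain ⟨z, hz, hzI⟩ : ∃ z, counit (R := k) z = 1 ∧
        z ∈ LinearMap.range (dualActOn (k := k) t) :=
      ⟨dualAct β t, (counit_dualAct β t).trans hβ, β, rfl⟩
    let r := Coalgebra.Repr.arbitrary k z
    -- Expanding `z₂` in the dual basis writes `Σ S(z₂) z₁` through the two stable operations only.
    have h1 : ∑ i, antipode k (v i) * dualAct (g i) z = 1 := by
      have h2 := sum_antipode_right_mul_left hS r
      rw [hz, one_smul] at h2
      rw [← h2]
      simp_rw [dualAct_apply]
      rw [← r.eq]
      simp_rw [map_sum, slice_tmul, Finset.mul_sum]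
      rw [Finset.sum_comm]
      refine Finset.sum_congr rfl fun j _ => ?_
      conv_rhs => rw [← hrep (r.right j), map_sum, Finset.sum_mul]
      refine Finset.sum_congr rfl fun i _ => ?_
      simp
    rw [← h1]
    exact Submodule.sum_mem _ fun i _ => hmul _ _ (hact _ _ hzI)
  intro x
  have := hmul x 1 hone
  rwa [mul_one] at this

/-- An involutory Frobenius Hopf algebra has a left integral `t` and a linear form `lam` with
`Σ lam(h₂) h₁ = lam(h) 1` and `lam(t) = 1`. -/
theorem exists_integrals (hS : IsInvolutory k H) (hF : IsFrobenius k H) :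
    ∃ (t : H) (lam : H →ₗ[k] k), t ∈ leftIntegrals k H ∧ (∀ h, dualAct lam h = lam h • (1 : H)) ∧
      dualAct lam t = 1 := by
  obtain ⟨_, _, e, he⟩ := hF
  obtain ⟨t, ht⟩ := e.surjective (counit : H →ₗ[k] k)
  have htI : t ∈ leftIntegrals k H := by
    intro b
    apply e.injective
    ext x
    rw [he, ht, map_smul, LinearMap.smul_apply, ht, Bialgebra.counit_mul, smul_eq_mul, mul_comm]
  have hβ : e 1 t = 1 := by
    have := he t 1 1
    rw [mul_one, one_mul, ht, Bialgebra.counit_one] at this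
    exact this.symm
  have hsurj := dualActOn_surjective hS htI hβ
  have hinj : Function.Injective (dualActOn (k := k) t) := by
    -- Composed with the Frobenius isomorphism, the map is a surjective endomorphism of a finite
    -- `k`-module, hence injective.
    have h := OrzechProperty.injective_of_surjective_endomorphism
      (dualActOn (k := k) t ∘ₗ e.toLinearMap) (hsurj.comp e.surjective)
    intro φ ψ hφψ
    obtain ⟨a, rfl⟩ := e.surjective φ
    obtain ⟨b, rfl⟩ := e.surjective ψ
    rw [h hφψ]
  obtain ⟨lam, hlam⟩ := hsurj 1
  refine ⟨t, lam, htI, fun h => ?_, hlam⟩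
  rw [← sub_eq_zero, ← Module.forall_dual_apply_eq_zero_iff k]
  intro ψ
  -- Both forms act on `t` as `ψ(1) 1`, because `lam ⇀ t = 1`.
  have h1 : ψ ∘ₗ dualAct lam = ψ 1 • lam := by
    apply hinj
    rw [map_smul, hlam, ← dualAct_one, ← hlam]
    exact (dualAct_dualAct ψ lam t).symm
  have h2 := LinearMap.congr_fun h1 h
  rw [LinearMap.comp_apply] at h2
  rw [map_sub, h2, map_smul, LinearMap.smul_apply, smul_eq_mul, smul_eq_mul, mul_comm, sub_self]

/-- `Σ lam(S(t₁) b t₂) = ε(t) lam(S(b))`. -/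
theorem sum_apply_antipode_mul_mul (hS : IsInvolutory k H) {t : H} (ht : t ∈ leftIntegrals k H)
    {lam : H →ₗ[k] k} (hlam : dualAct lam t = 1) {ι : Type*} (r : Coalgebra.Repr k t ι) (b : H) :
    ∑ i ∈ r.index, lam (antipode k (r.left i) * b * r.right i) =
      counit (R := k) t * lam (antipode k b) := by
  -- This recovers the antipode from `t` and `lam`. It is used below once to expand `S(t₁)` with a
  -- second copy of `t`, and once to contract the first copy.
  have hx : ∀ x : H, ∑ i ∈ r.index, lam (x * r.right i) • r.left i = antipode k x := by
    intro x
    have := mul_dualAct_of_mem_leftIntegrals hS ht lam (antipode k x)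
    rw [hlam, mul_one, hS x, dualAct_apply, ← r.eq, map_sum] at this
    rw [this]
    simp [slice_tmul]
  calc ∑ i ∈ r.index, lam (antipode k (r.left i) * b * r.right i)
      = ∑ i ∈ r.index, ∑ j ∈ r.index,
          lam (r.left i * r.right j) * lam (r.left j * b * r.right i) := by
        refine Finset.sum_congr rfl fun i _ => ?_
        rw [← hx (r.left i)]
        simp [Finset.sum_mul]
    _ = ∑ j ∈ r.index, lam (antipode k (r.left j * b) * r.right j) := by
        rw [Finset.sum_comm]
        refine Finset.sum_congr rfl fun j _ => ?_
        rw [← hx (r.left j * b)]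
        simp [Finset.sum_mul, mul_comm]
    _ = lam (antipode k b * ∑ j ∈ r.index, antipode k (r.left j) * r.right j) := by
        simp [antipode_mul_antidistrib, Finset.mul_sum, mul_assoc]
    _ = counit (R := k) t * lam (antipode k b) := by
        rw [sum_antipode_mul_eq_smul]
        simp

end Integrals

/-! ### Rank as the trace of a dual basis -/

section ConstantRank

variable {A : Type*} [CommRing A] {M : Type*} [AddCommGroup M] [Module A M]

theorem sum_dualBasis_eq_finrank [Module.Free A M] [Module.Finite A M] {σ : Type*} [Fintype σ]
    (u : σ → M) (φ : σ → M →ₗ[A] A) (h : ∀ m, ∑ s, φ s m • u s = m) :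
    ∑ s, φ s (u s) = (Module.finrank A M : A) := by
  have hid : (LinearMap.id : M →ₗ[A] M) = ∑ s, (φ s).smulRight (u s) := by
    ext m
    simp [LinearMap.sum_apply, h]
  rw [← LinearMap.trace_id, hid, map_sum]
  simp

theorem projective_of_dualBasis {σ : Type*} [Fintype σ]
    (u : σ → M) (φ : σ → M →ₗ[A] A) (h : ∀ m, ∑ s, φ s m • u s = m) :
    Module.Finite A M ∧ Module.Projective A M := by
  have hc : Fintype.linearCombination A u ∘ₗ LinearMap.pi φ = LinearMap.id := by
    ext m
    simp [Fintype.linearCombination_apply, h]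
  refine ⟨Module.Finite.of_surjective (Fintype.linearCombination A u) fun m => ?_,
    Module.Projective.of_split _ _ hc⟩
  exact ⟨LinearMap.pi φ m, LinearMap.congr_fun hc m⟩

/-- A dual basis stays one after base change to the local ring, where the module is free and the
trace of the identity is the rank. -/
theorem algebraMap_sum_dualBasis {σ : Type*} [Fintype σ]
    (u : σ → M) (φ : σ → M →ₗ[A] A) (h : ∀ m, ∑ s, φ s m • u s = m) (p : PrimeSpectrum A) :
    algebraMap A (Localization.AtPrime p.asIdeal) (∑ s, φ s (u s)) =
      (Module.rankAtStalk (R := A) M p : Localization.AtPrime p.asIdeal) := by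
  obtain ⟨_, _⟩ := projective_of_dualBasis u φ h
  let L := Localization.AtPrime p.asIdeal
  have : Module.Free L (L ⊗[A] M) := Module.free_of_flat_of_isLocalRing
  rw [Module.rankAtStalk_eq_finrank_tensorProduct,
    ← sum_dualBasis_eq_finrank (A := L) (fun s => (1 : L) ⊗ₜ[A] u s)
      (fun s => (TensorProduct.AlgebraTensorModule.rid A L L).toLinearMap ∘ₗ
        (φ s).baseChange L) ?_]
  · simp [Algebra.algebraMap_eq_smul_one]
  · intro m
    induction m using TensorProduct.induction_on with
    | zero => simp
    | tmul x y =>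
      conv_rhs => rw [← h y, TensorProduct.tmul_sum]
      refine Finset.sum_congr rfl fun s _ => ?_
      simp [TensorProduct.smul_tmul']
    | add x y hx hy =>
      conv_rhs => rw [← hx, ← hy]
      simp [add_smul, Finset.sum_add_distrib]

theorem exists_rankAtStalk_eq [Module.Finite A M] [Module.Projective A M]
    (hA : ∀ e : A, IsIdempotentElem e → e = 0 ∨ e = 1) :
    ∃ n : ℕ, ∀ p : PrimeSpectrum A, Module.rankAtStalk (R := A) M p = n := by
  rcases isEmpty_or_nonempty (PrimeSpectrum A) with hE | ⟨⟨p₀⟩⟩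
  -- Here `A` is the zero ring, so any value would do.
  · exact ⟨0, fun p => hE.elim p⟩
  have : Module.FinitePresentation A M := Module.finitePresentation_of_projective A M
  refine ⟨Module.rankAtStalk (R := A) M p₀, fun p => ?_⟩
  -- Fibres of the rank are clopen, hence cut out by an idempotent; the fibre through `p₀` is
  -- nonempty, so it is the whole spectrum.
  have hcl := (Module.isLocallyConstant_rankAtStalk (R := A) (M := M)).isClopen_fiber
    (Module.rankAtStalk (R := A) M p₀)
  obtain ⟨e, he, hs⟩ := PrimeSpectrum.isClopen_iff.mp hcl
  have h0 : p₀ ∈ {x | Module.rankAtStalk (R := A) M x = Module.rankAtStalk (R := A) M p₀} := rfl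
  change p ∈ {x | Module.rankAtStalk (R := A) M x = Module.rankAtStalk (R := A) M p₀}
  rw [hs] at h0 ⊢
  rcases hA e he with rfl | rfl
  · simp at h0
  · simp

/-- A module with a finite dual basis over a commutative ring without nontrivial idempotents has
constant rank, and its rank is the trace of the identity. -/
theorem exists_hasConstantRank_of_dualBasis
    (hA : ∀ e : A, IsIdempotentElem e → e = 0 ∨ e = 1) {σ : Type*} [Fintype σ]
    (u : σ → M) (φ : σ → M →ₗ[A] A) (h : ∀ m, ∑ s, φ s m • u s = m) :
    ∃ n : ℕ, (Module.Finite A M ∧ Module.Projective A M ∧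
      ∀ p : PrimeSpectrum A, Module.rankAtStalk (R := A) M p = n) ∧
        ∑ s, φ s (u s) = (n : A) := by
  obtain ⟨hF, hP⟩ := projective_of_dualBasis u φ h
  obtain ⟨n, hn⟩ := exists_rankAtStalk_eq (M := M) hA
  refine ⟨n, ⟨hF, hP, hn⟩, ?_⟩
  rw [← sub_eq_zero]
  refine eq_zero_of_localization _ fun J hJ => ?_
  have := algebraMap_sum_dualBasis u φ h ⟨J, hJ.isPrime⟩
  rw [hn] at this
  rw [map_sub, map_natCast, sub_eq_zero]
  exact this

end ConstantRank

/-! ### The Galois condition and a dual basis over the coinvariants -/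

namespace RightComoduleAlgebra

variable {k : Type*} [CommRing k] {H : Type*} [Ring H] [HopfAlgebra k H]
  {B : Type*} [Ring B] [Algebra k B] (ρ : RightComoduleAlgebra k H B)

/-- The linear map `b ⊗ h ↦ ρ(b) (1 ⊗ S(h))`, which intertwines the two canonical maps. -/
noncomputable def twist : B ⊗[k] H →ₗ[k] B ⊗[k] H :=
  lift ((LinearMap.mul k (B ⊗[k] H)).compl₁₂ ρ.coaction.toLinearMap
    ((Algebra.TensorProduct.includeRight : H →ₐ[k] B ⊗[k] H).toLinearMap ∘ₗ antipode k))

theorem twist_tmul (b : B) (h : H) :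
    ρ.twist (b ⊗ₜ h) = ρ.coaction b * ((1 : B) ⊗ₜ[k] antipode k h) := rfl

theorem twist_mul (b : B) (X : B ⊗[k] H) :
    ρ.twist ((b ⊗ₜ[k] (1 : H)) * X) = ρ.coaction b * ρ.twist X := by
  induction X using TensorProduct.induction_on with
  | zero => simp
  | tmul x y => simp [twist_tmul, mul_assoc]
  | add x y hx hy => simp only [mul_add, map_add, hx, hy]

theorem twist_coaction (c : B) : ρ.twist (ρ.coaction c) = c ⊗ₜ[k] (1 : H) := by
  have key : ρ.twist = (LinearMap.mul' k H ∘ₗ (antipode k).lTensor H).lTensor B ∘ₗ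
      (TensorProduct.assoc k B H H).toLinearMap ∘ₗ ρ.coaction.toLinearMap.rTensor H := by
    ext u v
    simp only [AlgebraTensorModule.curry_apply, curry_apply, LinearMap.coe_restrictScalars,
      twist_tmul, LinearMap.comp_apply, LinearMap.rTensor_tmul, LinearEquiv.coe_coe,
      AlgHom.toLinearMap_apply]
    induction ρ.coaction u using TensorProduct.induction_on with
    | zero => simp
    | tmul x y => simp
    | add x y hx hy => rw [add_mul, hx, hy, add_tmul, map_add, map_add]
  rw [key, LinearMap.comp_apply, LinearMap.comp_apply, LinearEquiv.coe_coe, ρ.coassoc,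
    ← LinearMap.comp_apply, ← LinearMap.lTensor_comp, LinearMap.comp_assoc,
    mul_antipode_lTensor_comul, LinearMap.lTensor_comp, LinearMap.comp_apply, ρ.counit]
  simp

theorem twist_preCanLeft (T : B ⊗[k] B) : ρ.twist (ρ.preCanLeft T) = ρ.preCanRight T := by
  induction T using TensorProduct.induction_on with
  | zero => simp
  | tmul b c => rw [preCanLeft_tmul, preCanRight_tmul, twist_mul, twist_coaction]
  | add x y hx hy => simp only [map_add, hx, hy]

/-- In a Galois extension over an involutory Hopf algebra every `1 ⊗ t` is of the form
`Σ ρ(lᵢ) (rᵢ ⊗ 1)`. -/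
theorem exists_sum_coaction_mul (hG : ρ.IsGaloisExtension) (hS : IsInvolutory k H) (t : H) :
    ∃ (n : ℕ) (l r : Fin n → B),
      ∑ i, ρ.coaction (l i) * (r i ⊗ₜ[k] (1 : H)) = (1 : B) ⊗ₜ[k] t := by
  obtain ⟨T, hT⟩ : ∃ T : B ⊗[k] B, ρ.preCanRight T = (1 : B) ⊗ₜ[k] t := by
    rcases hG with hG | hG
    -- `S(t)` is chosen because `twist` sends `1 ⊗ S(t)` to `1 ⊗ S²(t) = 1 ⊗ t`.
    · obtain ⟨q, hq⟩ := hG.surjective ((1 : B) ⊗ₜ[k] antipode k t)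
      obtain ⟨T, rfl⟩ := Submodule.mkQ_surjective _ q
      refine ⟨T, ?_⟩
      have hq' : ρ.preCanLeft T = (1 : B) ⊗ₜ[k] antipode k t := hq
      rw [← twist_preCanLeft, hq', twist_tmul, map_one, one_mul, hS t]
    · obtain ⟨q, hq⟩ := hG.surjective ((1 : B) ⊗ₜ[k] t)
      obtain ⟨T, rfl⟩ := Submodule.mkQ_surjective _ q
      exact ⟨T, hq⟩
  obtain ⟨S, rfl⟩ := TensorProduct.exists_finset T
  refine ⟨S.card, fun i => (S.equivFin.symm i).1.1, fun i => (S.equivFin.symm i).1.2, ?_⟩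
  rw [← hT, map_sum, Equiv.sum_comp S.equivFin.symm
    (fun x => ρ.coaction x.1.1 * (x.1.2 ⊗ₜ[k] (1 : H)))]
  simp_rw [preCanRight_tmul]
  exact Finset.sum_coe_sort S (fun x => ρ.coaction x.1 * (x.2 ⊗ₜ[k] (1 : H)))

/-- The map `b ↦ Σ lam(b₁) b₀`. -/
noncomputable def expectation (lam : H →ₗ[k] k) : B →ₗ[k] B :=
  slice B lam ∘ₗ ρ.coaction.toLinearMap

theorem expectation_apply (lam : H →ₗ[k] k) (b : B) :
    ρ.expectation lam b = slice B lam (ρ.coaction b) := rfl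

/-- Coassociativity turns `ρ(E(b))` into `Σ b₀ ⊗ (lam ⇀ b₁)`, and `lam ⇀ h = lam(h) 1`. -/
theorem expectation_mem {lam : H →ₗ[k] k} (hlam : ∀ h, dualAct lam h = lam h • (1 : H)) (b : B) :
    ρ.expectation lam b ∈ ρ.coinvariants := by
  have key : ∀ X : B ⊗[k] H, ρ.coaction (slice B lam X) = (slice H lam).lTensor B
      (TensorProduct.assoc k B H H (ρ.coaction.toLinearMap.rTensor H X)) := by
    intro X
    induction X using TensorProduct.induction_on with
    | zero => simp
    | tmul x y =>
      rw [slice_tmul, map_smul, LinearMap.rTensor_tmul, AlgHom.toLinearMap_apply]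
      induction ρ.coaction x using TensorProduct.induction_on with
      | zero => simp
      | tmul u v => simp [slice_tmul]
      | add u v hu hv => simp only [map_add, smul_add, add_tmul, hu, hv]
    | add x y hx hy => simp only [map_add, hx, hy]
  rw [mem_coinvariants, expectation_apply, key, ρ.coassoc]
  induction ρ.coaction b using TensorProduct.induction_on with
  | zero => simp
  | tmul u v =>
    rw [LinearMap.lTensor_tmul, LinearMap.lTensor_tmul, ← dualAct_apply, hlam, slice_tmul,
      tmul_smul, smul_tmul']
  | add u v hu hv => simp only [map_add, add_tmul, hu, hv]

theorem expectation_mul_left (lam : H →ₗ[k] k) {a : B} (ha : a ∈ ρ.coinvariants) (b : B) :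
    ρ.expectation lam (a * b) = a * ρ.expectation lam b := by
  rw [mem_coinvariants] at ha
  rw [expectation_apply, map_mul, ha, slice_mul_left, expectation_apply]

/-- The sum is the slice along `lam` of `ρ(b)(1 ⊗ t)`; since `lam(ht) = ε(h)`, counitality gives
`b`. -/
theorem sum_expectation_mul {t : H} {lam : H →ₗ[k] k}
    (hlt : lam ∘ₗ LinearMap.mulRight k t = Coalgebra.counit) {ι : Type*} [Fintype ι] {l r : ι → B}
    (hlr : ∑ i, ρ.coaction (l i) * (r i ⊗ₜ[k] (1 : H)) = (1 : B) ⊗ₜ[k] t) (b : B) :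
    ∑ i, ρ.expectation lam (b * l i) * r i = b := by
  have : ∀ i, ρ.expectation lam (b * l i) * r i =
      slice B lam (ρ.coaction b * (ρ.coaction (l i) * (r i ⊗ₜ[k] (1 : H)))) := by
    intro i
    rw [expectation_apply, map_mul, ← slice_mul_right, mul_assoc]
  simp_rw [this]
  rw [← map_sum, ← Finset.mul_sum, hlr, slice_mul_one_tmul, hlt, slice, LinearMap.comp_apply,
    ρ.counit]
  simp

/-! ### The trace form applied to the trace of the dual basis -/

/-- The algebra map `b ⊗ h ↦ b ⊗ (h ⊗ 1)`. -/
noncomputable def inclFirst (k H B : Type*) [CommRing k] [Ring H] [HopfAlgebra k H] [Ring B]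
    [Algebra k B] : B ⊗[k] H →ₐ[k] B ⊗[k] (H ⊗[k] H) :=
  Algebra.TensorProduct.map (AlgHom.id k B) Algebra.TensorProduct.includeLeft

/-- The algebra map `b ⊗ h ↦ b ⊗ (1 ⊗ h)`. -/
noncomputable def inclSecond (k H B : Type*) [CommRing k] [Ring H] [HopfAlgebra k H] [Ring B]
    [Algebra k B] : B ⊗[k] H →ₐ[k] B ⊗[k] (H ⊗[k] H) :=
  Algebra.TensorProduct.map (AlgHom.id k B) Algebra.TensorProduct.includeRight

theorem inclFirst_tmul (b : B) (h : H) :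
    inclFirst k H B (b ⊗ₜ h) = b ⊗ₜ (h ⊗ₜ 1) := rfl

theorem inclSecond_tmul (b : B) (h : H) :
    inclSecond k H B (b ⊗ₜ h) = b ⊗ₜ (1 ⊗ₜ h) := rfl

/-- The linear map `x ⊗ v ↦ x₀ ⊗ S(v₁) x₁ ⊗ v₂`. -/
noncomputable def unwind : B ⊗[k] H →ₗ[k] B ⊗[k] (H ⊗[k] H) :=
  lift ((LinearMap.mul k (B ⊗[k] (H ⊗[k] H))).compl₁₂
    ((Algebra.TensorProduct.includeRight : H ⊗[k] H →ₐ[k] B ⊗[k] (H ⊗[k] H)).toLinearMap ∘ₗ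
      (antipode k).rTensor H ∘ₗ (comul : H →ₗ[k] H ⊗[k] H))
    ((inclFirst k H B).comp ρ.coaction).toLinearMap).flip

theorem unwind_tmul (x : B) (v : H) : ρ.unwind (x ⊗ₜ v) =
    ((1 : B) ⊗ₜ[k] (antipode k).rTensor H (comul (R := k) v)) *
      inclFirst k H B (ρ.coaction x) := rfl

theorem unwind_mul (X : B ⊗[k] H) (r : B) :
    ρ.unwind (X * (r ⊗ₜ[k] (1 : H))) = ρ.unwind X * inclFirst k H B (ρ.coaction r) := by
  induction X using TensorProduct.induction_on with
  | zero => simp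
  | tmul x y =>
    rw [Algebra.TensorProduct.tmul_mul_tmul, mul_one, unwind_tmul, unwind_tmul, map_mul, map_mul,
      mul_assoc]
  | add x y hx hy => simp only [add_mul, map_add, hx, hy]

/-- The left side is `Σ l₀ ⊗ S(l₂) l₁ ⊗ l₃`, whose middle factor cancels by
`antipodeComulMul_comul`. -/
theorem unwind_coaction (hS : IsInvolutory k H) (l : B) :
    ρ.unwind (ρ.coaction l) = inclSecond k H B (ρ.coaction l) := by
  have key : ρ.unwind = (antipodeComulMul k H).lTensor B ∘ₗ
      (TensorProduct.assoc k B H H).toLinearMap ∘ₗ ρ.coaction.toLinearMap.rTensor H := by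
    ext u v
    simp only [AlgebraTensorModule.curry_apply, curry_apply, LinearMap.coe_restrictScalars,
      unwind_tmul, LinearMap.comp_apply, LinearMap.rTensor_tmul, LinearEquiv.coe_coe,
      AlgHom.toLinearMap_apply]
    induction ρ.coaction u using TensorProduct.induction_on with
    | zero => simp
    | tmul x y => simp [inclFirst_tmul, antipodeComulMul_tmul]
    | add x y hx hy => rw [map_add, mul_add, hx, hy, add_tmul, map_add, map_add]
  rw [key, LinearMap.comp_apply, LinearMap.comp_apply, LinearEquiv.coe_coe, ρ.coassoc]
  induction ρ.coaction l using TensorProduct.induction_on with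
  | zero => simp
  | tmul x y => simp [inclSecond_tmul, antipodeComulMul_comul hS]
  | add x y hx hy => simp only [map_add, hx, hy]

/-- `Σ l₀ r₀ ⊗ r₁ ⊗ l₁ = 1 ⊗ S(t₁) ⊗ t₂`. -/
theorem sum_inclSecond_mul_inclFirst (hS : IsInvolutory k H) {t : H} {ι : Type*} [Fintype ι]
    {l r : ι → B}
    (hlr : ∑ i, ρ.coaction (l i) * (r i ⊗ₜ[k] (1 : H)) = (1 : B) ⊗ₜ[k] t) :
    ∑ i, inclSecond k H B (ρ.coaction (l i)) * inclFirst k H B (ρ.coaction (r i)) =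
      (1 : B) ⊗ₜ[k] (antipode k).rTensor H (comul (R := k) t) := by
  have := congrArg ρ.unwind hlr
  rw [map_sum, unwind_tmul, map_one, map_one, mul_one] at this
  rw [← this]
  simp_rw [unwind_mul, unwind_coaction ρ hS]

/-- Cyclicity of `f` brings the `B`-factor of `Z` to the front, while the `H`-factors keep their
order. The right side is thus linear in the element evaluated by `sum_inclSecond_mul_inclFirst`. -/
theorem apply_slice_mul_mul {f : B →ₗ[k] k} (hf : IsTraceForm f) (lam : H →ₗ[k] k)
    (p : B) (q : H) (X Z : B ⊗[k] H) :
    f (slice B lam (X * (p ⊗ₜ[k] q) * Z)) =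
      (LinearMap.mul' k k ∘ₗ TensorProduct.map (f ∘ₗ LinearMap.mulRight k p)
        (lam ∘ₗ LinearMap.mul' k H ∘ₗ (LinearMap.mulRight k q).rTensor H))
          (inclSecond k H B Z * inclFirst k H B X) := by
  induction X using TensorProduct.induction_on with
  | zero => simp
  | tmul r u =>
    induction Z using TensorProduct.induction_on with
    | zero => simp
    | tmul l v =>
      have := hf (r * p) l
      rw [map_sub, sub_eq_zero] at this
      rw [mul_assoc] at this
      simp [inclFirst_tmul, inclSecond_tmul, slice_tmul, this, mul_assoc, mul_comm]
    | add x y hx hy => simp only [add_mul, mul_add, map_add, hx, hy]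
  | add x y hx hy => simp only [add_mul, mul_add, map_add, hx, hy]

/-- A trace form applied to `Σ E(rᵢ b lᵢ)` is a multiple of `ε(t)`. -/
theorem trace_sum_expectation (hS : IsInvolutory k H) {t : H} (ht : t ∈ leftIntegrals k H)
    {lam : H →ₗ[k] k} (hlam : dualAct lam t = 1) {ι : Type*} [Fintype ι] {l r : ι → B}
    (hlr : ∑ i, ρ.coaction (l i) * (r i ⊗ₜ[k] (1 : H)) = (1 : B) ⊗ₜ[k] t)
    {f : B →ₗ[k] k} (hf : IsTraceForm f) (b : B) :
    f (∑ i, ρ.expectation lam (r i * b * l i)) =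
      Coalgebra.counit (R := k) t * f (slice B (lam ∘ₗ antipode k) (ρ.coaction b)) := by
  simp_rw [expectation_apply, map_mul]
  induction ρ.coaction b using TensorProduct.induction_on with
  | zero => simp
  | tmul p q =>
    rw [map_sum]
    simp_rw [apply_slice_mul_mul hf]
    rw [← map_sum, sum_inclSecond_mul_inclFirst ρ hS hlr]
    have h := sum_apply_antipode_mul_mul hS ht hlam (Coalgebra.Repr.arbitrary k t) q
    rw [← (Coalgebra.Repr.arbitrary k t).eq]
    simp only [LinearMap.comp_apply, tmul_sum, TensorProduct.map_tmul, map_sum, LinearMap.rTensor_tmul,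
      LinearMap.mul'_apply, LinearMap.mulRight_apply, one_mul, slice_tmul, map_smul,
      smul_eq_mul, ← Finset.mul_sum, h]
    ring
  | add x y hx hy =>
    simp only [add_mul, mul_add, map_add, Finset.sum_add_distrib] at hx hy ⊢
    rw [hx, hy]

/-- The `A`-linear functional `m ↦ E(g(m) l)` on a `B`-module, for a `B`-linear functional `g`. -/
noncomputable def functional {lam : H →ₗ[k] k} (hlam : ∀ h, dualAct lam h = lam h • (1 : H))
    {M : Type*} [AddCommGroup M] [Module B M] (g : M →ₗ[B] B) (l : B) :
    M →ₗ[ρ.coinvariants] ρ.coinvariants where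
  toFun m := ⟨ρ.expectation lam (g m * l), ρ.expectation_mem hlam _⟩
  map_add' x y := by
    ext
    simp [add_mul]
  map_smul' a m := by
    ext
    have : g (a • m) = (a : B) * g m := map_smul g (a : B) m
    simp [this, mul_assoc, ρ.expectation_mul_left lam a.2]

end RightComoduleAlgebra

end HopfGalois

open scoped IsMulCommutative
theorem theorem3p7
    {k : Type*} [CommRing k]
    {H : Type*} [Ring H] [HopfAlgebra k H]
    {B : Type*} [Ring B] [Algebra k B]
    (ρ : HopfGalois.RightComoduleAlgebra k H B)
    (hGalois : ρ.IsGaloisExtension)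
    (hInv : HopfGalois.IsInvolutory k H)
    (hFrob : HopfGalois.IsFrobenius k H)
    [IsMulCommutative ρ.coinvariants]
    (hIdem : ∀ e : ρ.coinvariants, IsIdempotentElem e → e = 0 ∨ e = 1)
    (hTrace : ∃ f : B →ₗ[k] k, HopfGalois.IsTraceForm f ∧ f 1 = 1)
    (M : Type*) [AddCommGroup M] [Module B M] [Module.Finite B M] [Module.Projective B M] :
    ∃ n : ℕ, HopfGalois.HasConstantRank ρ.coinvariants M n ∧
      (n : k) ∈ HopfGalois.integralIdeal k H := by
  obtain ⟨f, hf, hf1⟩ := hTrace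
  obtain ⟨t, lam, ht, hlam, hlt⟩ := HopfGalois.exists_integrals hInv hFrob
  have hlt1 : lam t = 1 := by
    rw [← HopfGalois.counit_dualAct, hlt, Bialgebra.counit_one]
  have hltc : lam ∘ₗ LinearMap.mulRight k t = Coalgebra.counit := by
    ext h
    simp [ht h, hlt1]
  obtain ⟨n, l, r, hlr⟩ := ρ.exists_sum_coaction_mul hGalois hInv t
  obtain ⟨N, m, g, hmg⟩ := HopfGalois.exists_dualBasis B M
  obtain ⟨d, hd, hsum⟩ := HopfGalois.exists_hasConstantRank_of_dualBasis (A := ρ.coinvariants)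
    hIdem (σ := Fin N × Fin n) (fun s => r s.2 • m s.1)
    (fun s => ρ.functional hlam (g s.1) (l s.2)) (fun x => by
      rw [Fintype.sum_prod_type]
      conv_rhs => rw [← hmg x]
      refine Finset.sum_congr rfl fun j _ => ?_
      have hE := congrArg (· • m j) (ρ.sum_expectation_mul hltc hlr (g j x))
      simp only [Finset.sum_smul, mul_smul] at hE
      exact hE)
  refine ⟨d, hd, ?_⟩
  have hsum' : ∑ i, ρ.expectation lam (r i * (∑ j, g j (m j)) * l i) = (d : B) := by
    have := congrArg (Subtype.val : ρ.coinvariants → B) hsum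
    rw [Fintype.sum_prod_type_right] at this
    simp only [Finset.mul_sum, Finset.sum_mul, map_sum]
    simpa [HopfGalois.RightComoduleAlgebra.functional] using this
  have htr := ρ.trace_sum_expectation hInv ht hlt hlr hf (∑ j, g j (m j))
  -- `f(1) = 1` turns the rank as an element of `B` into its image in `k`.
  rw [hsum', ← nsmul_one, map_nsmul, hf1, nsmul_one] at htr
  rw [htr, HopfGalois.integralIdeal_eq_left k H hInv, mul_comm]
  exact Submodule.smul_mem _ _ ⟨t, ht, rfl⟩
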